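/- Let $r\ge 2$, $1\le i\le r$ and $J\ge 0$ be integers, put $\ell=r-i+1$, and let $\mathbb{F}$ be a field of characteristic zero. For $1\le k\le r$ define the formal power series $$\mathcal{A}_k(q)=\prod_{\substack{m\ge 1\\ m\not\equiv 0,\ \pm(r-k+1)\ (\mathrm{mod}\ 2r+1)}}\frac{1}{1-q^m},$$ and for $g\ge 1$ define recursively, in the ring of formal Laurent series, $\mathcal{A}_{(r-1)g+1}=\mathcal{A}_{(r-1)(g-1)+r}$ and, for $2\le h\le r$, $$\mathcal{A}_{(r-1)g+h}(q)=\frac{\mathcal{A}_{(r-1)(g-1)+r-h+1}(q)-\mathcal{A}_{(r-1)(g-1)+r-h+2}(q)}{q^{g(h-1)}}.$$ Let $S_{J+1}=\mathbb{F}[x_{J+1},x_{J+2},\dots]$, graded by weight ($x_n$ has weight $n$), and let $P_{r,i,J}$ be the ideal of $S_{J+1}$ generated by $x_{J+1}^{i}$, by $x_{J+1}^{i-s}x_{J+2}^{r-i+s}$ for $1\le s\le i-1$, and by $x_a^{r-t}x_{a+1}^{t}$ for $a\ge J+2$ and $0\le t\le r-1$. Let $(S_{J+1}/P_{r,i,J})_j$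 be the image in $S_{J+1}/P_{r,i,J}$ of the space of polynomials of weight $j$, and let $$\mathrm{HP}_i^{J+1}(q)=\sum_{j\ge 0}\dim_{\mathbb{F}}\bigl(S_{J+1}/P_{r,i,J}\bigr)_j\,q^j .$$ Let $\mathcal{B}_{r,i,J}(q)=\sum_{n\ge0}B_{r,i,J}(n)q^n$, where $B_{r,i,J}(n)$ is the number of partitions $\lambda_1\ge\lambda_2\ge\dots\ge\lambda_s$ of $n$ such that $\lambda_m-\lambda_{m+r-1}\ge 2$ for all $m\ge 1$ with $m+r-1\le s$, all parts are greater than $J$, and at most $i-1$ parts are equal to $J+1$ (the empty partition is counted for $n=0$). Then all the dimensions above are finite, and $$\mathcal{A}_{(r-1)J+\ell}(q)=\mathrm{HP}_i^{J+1}(q),\qquad \mathrm{HP}_i^{J+1}(q)=\mathcal{B}_{r,i,J}(q).$$ Consequently $\mathcal{A}_{(r-1)J+\ell}(q)=\mathcal{B}_{r,i,J}(q)$. In particular, from the case $J=0$, for all $n\ge 0$ the number of partitions of $n$ into parts not congruent to $0$ or $\pm i$ modulo $2r+1$ equals the number of partitions of $n$ with $\lambda_m-\lambda_{m+r-1}\ge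 2$ whenever both parts exist and at most $i-1$ parts equal to $1$. -/

import Mathlib

/-! ### The product series and the recursively defined series -/

/-- `m` is congruent neither to `0` nor to `± s` modulo `2 r + 1`. -/
def AllowedPart (r : ℕ) (s : ℤ) (m : ℕ) : Prop :=
  ¬ (m : ℤ) ≡ 0 [ZMOD 2 * r + 1] ∧ ¬ (m : ℤ) ≡ s [ZMOD 2 * r + 1] ∧
    ¬ (m : ℤ) ≡ -s [ZMOD 2 * r + 1]

instance (r : ℕ) (s : ℤ) : DecidablePred (AllowedPart r s) := fun m => by
  unfold AllowedPart; infer_instance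

/-- The factor `1 / (1 - q ^ m)` as an integral power series (for `m ≥ 1`). -/
noncomputable def eulerFactor (m : ℕ) : PowerSeries ℤ :=
  PowerSeries.invOfUnit (1 - PowerSeries.X ^ m) 1

theorem eulerFactor_mul (m : ℕ) (hm : 1 ≤ m) :
    eulerFactor m * (1 - PowerSeries.X ^ m) = 1 := by
  rw [mul_comm]
  apply PowerSeries.mul_invOfUnit
  have : m ≠ 0 := by omega
  simp [this]

open scoped PowerSeries.WithPiTopology in
/-- The infinite product `∏ 1 / (1 - q ^ m)` over all `m ≥ 1` with `m ≢ 0, ± s` modulo `2 r + 1`,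
as a formal power series; the product converges coefficientwise (the `q`-adic topology on `ℤ⟦q⟧`,
as `ℤ` is discrete). The index `m` of the product stands for the integer `m + 1`. -/
noncomputable def gordonProduct (r : ℕ) (s : ℤ) : PowerSeries ℤ :=
  ∏' m : ℕ, if AllowedPart r s (m + 1) then eulerFactor (m + 1) else 1

open scoped PowerSeries.WithPiTopology in
theorem gordonProduct_multipliable (r : ℕ) (s : ℤ) :
    Multipliable fun m : ℕ => if AllowedPart r s (m + 1) then eulerFactor (m + 1) else 1 := by
  have key : ∀ m : ℕ, eulerFactor (m + 1) =
      ∑' j : ℕ, (PowerSeries.X ^ ((m + 1) * j) : PowerSeries ℤ) := by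
    intro m
    have h0 : PowerSeries.constantCoeff (PowerSeries.X ^ (m + 1) : PowerSeries ℤ) = 0 := by simp
    have h := PowerSeries.WithPiTopology.one_sub_mul_tsum_pow_of_constantCoeff_eq_zero h0
    simp only [pow_mul]
    rw [← one_mul (∑' j : ℕ, _), ← eulerFactor_mul (m + 1) (by omega), mul_assoc, h, mul_one]
  simp only [key]
  exact Nat.Partition.multipliable_powerSeriesMk_card_restricted ℤ (AllowedPart r s)

/-- The series `𝒜_k(q)`, `k ≥ 1`. For `1 ≤ k ≤ r` it is the product over `m ≢ 0, ± (r - k + 1)`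
modulo `2 r + 1`. Every `k > r` is written in exactly one way as `k = (r - 1) g + i` with `g ≥ 1`
and `2 ≤ i ≤ r`, and then
`𝒜_k = (𝒜_{(r-1)(g-1)+r-i+1} - 𝒜_{(r-1)(g-1)+r-i+2}) / q ^ (g (i - 1))`.
The division by the power of `q` is carried out in the ring of formal Laurent series.
See `seriesA_base`, `seriesA_rec_one` and `seriesA_rec` below. -/
noncomputable def seriesA (r k : ℕ) : LaurentSeries ℤ :=
  if h : 2 ≤ r ∧ r < k then
    have h1 : (k - 2) / (r - 1) * (r - 1) + (k - 2) % (r - 1) = k - 2 := Nat.div_add_mod' _ _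
    have h2 : (k - 2) % (r - 1) < r - 1 := Nat.mod_lt _ (by omega)
    have h3 : (r - 1) * ((k - 2) / (r - 1) - 1) + (r - 1) ≤ (r - 1) * ((k - 2) / (r - 1)) := by
      have : 1 ≤ (k - 2) / (r - 1) := (Nat.one_le_div_iff (by omega)).2 (by omega)
      rw [← Nat.mul_succ]
      exact Nat.mul_le_mul le_rfl (by omega)
    have h4 := mul_comm (r - 1) ((k - 2) / (r - 1))
    let g := (k - 2) / (r - 1)
    let i := (k - 2) % (r - 1) + 2
    (seriesA r ((r - 1) * (g - 1) + (r - i + 1)) - seriesA r ((r - 1) * (g - 1) + (r - i + 2))) *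
      HahnSeries.single (-((g * (i - 1) : ℕ) : ℤ)) 1
  else HahnSeries.ofPowerSeries ℤ ℤ (gordonProduct r ((r : ℤ) - k + 1))
termination_by k
decreasing_by all_goals omega

theorem seriesA_base (r i : ℕ) (hi : i ≤ r) :
    seriesA r i = HahnSeries.ofPowerSeries ℤ ℤ (gordonProduct r ((r : ℤ) - i + 1)) := by
  rw [seriesA, dif_neg (by omega)]

theorem seriesA_rec_one (r g : ℕ) (hr : 2 ≤ r) (hg : 1 ≤ g) :
    seriesA r ((r - 1) * g + 1) = seriesA r ((r - 1) * (g - 1) + r) := by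
  obtain ⟨g, rfl⟩ := Nat.exists_eq_add_of_le' hg
  congr 1
  rw [Nat.mul_succ, Nat.add_sub_cancel]
  omega

theorem seriesA_rec (r g i : ℕ) (hr : 2 ≤ r) (hg : 1 ≤ g) (hi : 2 ≤ i) (hir : i ≤ r) :
    seriesA r ((r - 1) * g + i) =
      (seriesA r ((r - 1) * (g - 1) + (r - i + 1)) -
        seriesA r ((r - 1) * (g - 1) + (r - i + 2))) *
        HahnSeries.single (-((g * (i - 1) : ℕ) : ℤ)) 1 := by
  have hk : (r - 1) * g + i - 2 = (i - 2) + (r - 1) * g := by omega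
  have hd : ((r - 1) * g + i - 2) / (r - 1) = g := by
    rw [hk, Nat.add_mul_div_left _ _ (by omega), Nat.div_eq_of_lt (by omega), zero_add]
  have hm : ((r - 1) * g + i - 2) % (r - 1) + 2 = i := by
    rw [hk, Nat.add_mul_mod_self_left, Nat.mod_eq_of_lt (by omega)]; omega
  have hle : (r - 1) * 1 ≤ (r - 1) * g := Nat.mul_le_mul le_rfl hg
  rw [seriesA, dif_pos ⟨hr, by omega⟩]
  simp only [hd, hm]

/-! ### The partition functions -/

/-- The parts `λ₁ ≥ λ₂ ≥ ...` of a partition, in non-increasing order. -/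
def partList {n : ℕ} (p : n.Partition) : List ℕ := p.parts.sort (fun a b => a ≥ b)

/-- `λ_m - λ_{m+r-1} ≥ 2` whenever both parts exist. -/
def DifferenceCondition (r : ℕ) (L : List ℕ) : Prop :=
  ∀ (m : ℕ) (h : m + (r - 1) < L.length), L[m + (r - 1)] + 2 ≤ L[m]

/-- The number of partitions of `n` into parts not congruent to `0`, `± i` modulo `2 r + 1`. -/
def countA (r i n : ℕ) : ℕ := (Nat.Partition.restricted n (AllowedPart r i)).card

/-- The number of partitions of `n` with `λ_m - λ_{m+r-1} ≥ 2` and at most `i - 1` parts equal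
to `1`. -/
noncomputable def countB (r i n : ℕ) : ℕ :=
  Nat.card {p : n.Partition //
    DifferenceCondition r (partList p) ∧ p.parts.count 1 ≤ i - 1}

/-- The number of partitions of `n` with `λ_m - λ_{m+r-1} ≥ 2`, all parts greater than `J`, and at
most `i - 1` parts equal to `J + 1`. -/
noncomputable def countBJ (r i J n : ℕ) : ℕ :=
  Nat.card {p : n.Partition //
    DifferenceCondition r (partList p) ∧ (∀ a ∈ p.parts, J < a) ∧
      p.parts.count (J + 1) ≤ i - 1}

/-- The generating function `ℬ_{r,i,J}(q)`. -/
noncomputable def seriesB (r i J : ℕ) : PowerSeries ℤ :=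
  PowerSeries.mk fun n => (countBJ r i J n : ℤ)

/-! ### The graded algebra and its Hilbert–Poincaré series -/

/-- `S_k = F[x_k, x_{k+1}, ...]`. -/
abbrev PolyFrom (F : Type*) [Field F] (k : ℕ) : Type _ := MvPolynomial {n : ℕ // k ≤ n} F

/-- The variable `x_{k+j}` of `S_k`. -/
noncomputable def polyVar (F : Type*) [Field F] (k j : ℕ) : PolyFrom F k :=
  MvPolynomial.X ⟨k + j, Nat.le_add_right k j⟩

/-- The ideal of `S_k` generated by `x_k ^ i`, by `x_k ^ (i-s) x_{k+1} ^ (r-i+s)` for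
`1 ≤ s ≤ i - 1`, and by `x_a ^ (r-t) x_{a+1} ^ t` for `a ≥ k + 1` and `0 ≤ t ≤ r - 1`
(here `a = k + 1 + b`). The ideal `P_{r,i,J}` is the case `k = J + 1`. -/
noncomputable def gordonIdeal (F : Type*) [Field F] (r i k : ℕ) : Ideal (PolyFrom F k) :=
  Ideal.span
    ({polyVar F k 0 ^ i} ∪
      {f | ∃ s : ℕ, 1 ≤ s ∧ s ≤ i - 1 ∧ f = polyVar F k 0 ^ (i - s) * polyVar F k 1 ^ (r - i + s)} ∪
      {f | ∃ b t : ℕ, t ≤ r - 1 ∧ f = polyVar F k (1 + b) ^ (r - t) * polyVar F k (1 + b + 1) ^ t})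

/-- The homogeneous component of degree `j` of `S_k / I` for the grading by weight (`x_n` has
weight `n`), that is, the image `(S_k)_j / I_j` of the space of polynomials of weight `j`. -/
noncomputable def quotientComponent (F : Type*) [Field F] (k : ℕ) (I : Ideal (PolyFrom F k)) (j : ℕ) :
    Submodule F (PolyFrom F k ⧸ I) :=
  (MvPolynomial.weightedHomogeneousSubmodule F (fun n : {n : ℕ // k ≤ n} => (n : ℕ)) j).map
    (Ideal.Quotient.mkₐ F I).toLinearMap

/-- The series `∑ dim_F (A_j) q ^ j` of a family of subspaces `A_0, A_1, ...`. -/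
noncomputable def hilbertPoincare (F : Type*) [Field F] {A : Type*} [AddCommGroup A] [Module F A]
    (𝒜 : ℕ → Submodule F A) : PowerSeries ℤ :=
  PowerSeries.mk fun j => (Module.finrank F (𝒜 j) : ℤ)

/-- `HP_i ^ k`, the Hilbert–Poincaré series of `S_k` modulo the ideal `gordonIdeal F r i k`. -/
noncomputable def seriesHP (F : Type*) [Field F] (r i k : ℕ) : PowerSeries ℤ :=
  hilbertPoincare F (quotientComponent F k (gordonIdeal F r i k))

/-! Fix `r` and let B(i, J) be the generating function of the partitions in question, written
`gordonSeries`. Sorting by whether `J + 1` occurs exactly `i` times gives B(i+1, J) = B(i, J) +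
q^((J+1)i) B(r-i, J+1) for i < r, with B(0, J) = 0 (`gordonSeries_succ`). Solved for its last
factor, this is the recursion that defines `seriesA`, so the analytic claim reduces to J = 0: the
infinite product equals B(i, 0) (`gordonProduct_eq_gordonSeries`).

For that, Andrews' alternating series `gordonTheta` obeys the same recursion modulo q^N
(`modX_gordonTheta_succ`). Once J ≥ N and i ≥ 1, both it and (q;q)_N B(i, J) reduce to (q;q)_N
modulo q^N, so descending in J makes them agree everywhere (`modX_gordonSeries_mul`). At J = 0 the
alternating series is (q;q)_N times the infinite product modulo q^N, by the Jacobi triple product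
(`modX_jacobi_triple_product`). Working modulo q^N throughout keeps every sum and product finite.

On the algebraic side the ideal is generated by monomials, so the monomials outside it give a basis
of the quotient. Reading exponents as multiplicities of parts turns these monomials into exactly the
partitions counted by B (`image_exponentParts_standardExponents`). -/

/-! ### Gaussian binomials and the finite Jacobi triple product -/

open Finset in
/-- The `q`-Pochhammer product `(1 - Q) (1 - Q ^ 2) ⋯ (1 - Q ^ n)`. -/
def qFactorial {R : Type*} [CommRing R] (Q : R) (n : ℕ) : R :=
  ∏ j ∈ range n, (1 - Q ^ (j + 1))

theorem qFactorial_succ {R : Type*} [CommRing R] (Q : R) (n : ℕ) :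
    qFactorial Q (n + 1) = qFactorial Q n * (1 - Q ^ (n + 1)) :=
  Finset.prod_range_succ _ _

/-- The Gaussian binomial coefficients, defined by the `q`-Pascal recursion. -/
def qBinomial {R : Type*} [CommRing R] (Q : R) : ℕ → ℕ → R
  | _, 0 => 1
  | 0, _ + 1 => 0
  | n + 1, j + 1 => qBinomial Q n j + Q ^ (j + 1) * qBinomial Q n (j + 1)

theorem qBinomial_zero_right {R : Type*} [CommRing R] (Q : R) (n : ℕ) : qBinomial Q n 0 = 1 := by
  cases n <;> rfl

theorem qBinomial_succ_succ {R : Type*} [CommRing R] (Q : R) (n j : ℕ) :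
    qBinomial Q (n + 1) (j + 1) = qBinomial Q n j + Q ^ (j + 1) * qBinomial Q n (j + 1) := rfl

theorem qBinomial_eq_zero_of_lt {R : Type*} [CommRing R] (Q : R) (n j : ℕ) (h : n < j) :
    qBinomial Q n j = 0 := by
  induction n generalizing j with
  | zero => obtain ⟨j, rfl⟩ := Nat.exists_eq_add_of_lt h; simp [qBinomial]
  | succ n ih =>
    obtain ⟨j, rfl⟩ := Nat.exists_eq_add_of_le' (Nat.one_le_of_lt h)
    rw [qBinomial_succ_succ, ih j (by omega), ih (j + 1) (by omega)]
    simp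

theorem qBinomial_self {R : Type*} [CommRing R] (Q : R) (n : ℕ) : qBinomial Q n n = 1 := by
  induction n with
  | zero => rfl
  | succ n ih => rw [qBinomial_succ_succ, ih, qBinomial_eq_zero_of_lt Q n (n + 1) (by omega)]; simp

/-- The step rests on `1 - Q^(a+b+2) = (1 - Q^(a+1)) + Q^(a+1) (1 - Q^(b+1))`. The product form
avoids division and so holds in any commutative ring. -/
theorem qBinomial_mul_qFactorial {R : Type*} [CommRing R] (Q : R) (a b : ℕ) :
    qBinomial Q (a + b) a * (qFactorial Q a * qFactorial Q b) = qFactorial Q (a + b) := by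
  induction a generalizing b with
  | zero => simp [qBinomial_zero_right, qFactorial]
  | succ a iha =>
    induction b with
    | zero => simp [qBinomial_self, qFactorial]
    | succ b ihb =>
      have h1 := iha (b + 1)
      rw [show a + 1 + (b + 1) = (a + b + 1) + 1 by omega, qBinomial_succ_succ]
      rw [show a + (b + 1) = a + b + 1 by omega] at h1
      rw [show a + 1 + b = a + b + 1 by omega] at ihb
      rw [qFactorial_succ Q (a + b + 1)]
      have e1 := qFactorial_succ Q a
      have e2 := qFactorial_succ Q b
      calc _ = (qBinomial Q (a + b + 1) a * (qFactorial Q a * qFactorial Q (b + 1))) *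
              (1 - Q ^ (a + 1)) +
            Q ^ (a + 1) * (1 - Q ^ (b + 1)) *
              (qBinomial Q (a + b + 1) (a + 1) * (qFactorial Q (a + 1) * qFactorial Q b)) := by
            rw [e1, e2]; ring
        _ = _ := by rw [h1, ihb]; ring

/-- The `q`-binomial theorem, in homogeneous form. -/
theorem prod_add_mul_pow_eq_sum_qBinomial {R : Type*} [CommRing R] (Q x y : R) (n : ℕ) :
    ∏ j ∈ Finset.range n, (y + x * Q ^ j) =
      ∑ j ∈ Finset.range (n + 1), qBinomial Q n j * Q ^ (j.choose 2) * x ^ j * y ^ (n - j) := by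
  induction n generalizing x with
  | zero => simp [qBinomial]
  | succ n ih =>
    rw [Finset.prod_range_succ']
    -- Splitting off the factor `j = 0` leaves the product for `x * Q`, which is why the induction
    -- generalizes `x`.
    have h : ∏ j ∈ Finset.range n, (y + x * Q ^ (j + 1)) =
        ∏ j ∈ Finset.range n, (y + (x * Q) * Q ^ j) :=
      Finset.prod_congr rfl fun j _ => by ring
    rw [h, ih, pow_zero, mul_one, mul_add]
    have hy : (∑ j ∈ Finset.range (n + 1),
        qBinomial Q n j * Q ^ (j.choose 2) * (x * Q) ^ j * y ^ (n - j)) * y =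
        y ^ (n + 1) + ∑ j ∈ Finset.range (n + 1),
          Q ^ (j + 1) * qBinomial Q n (j + 1) * Q ^ ((j + 1).choose 2) * x ^ (j + 1) *
            y ^ (n + 1 - (j + 1)) := by
      rw [Finset.sum_range_succ', Finset.sum_range_succ,
        qBinomial_eq_zero_of_lt Q n (n + 1) (by omega), add_mul, Finset.sum_mul, add_comm]
      congr 1
      · simp [qBinomial_zero_right, pow_succ]
      · simp only [mul_zero, zero_mul, add_zero]
        refine Finset.sum_congr rfl fun j hj => ?_
        have hj' := Finset.mem_range.1 hj
        rw [show n + 1 - (j + 1) = (n - (j + 1)) + 1 by omega]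
        ring
    have hx : (∑ j ∈ Finset.range (n + 1),
        qBinomial Q n j * Q ^ (j.choose 2) * (x * Q) ^ j * y ^ (n - j)) * x =
        ∑ j ∈ Finset.range (n + 1),
          qBinomial Q n j * Q ^ ((j + 1).choose 2) * x ^ (j + 1) * y ^ (n + 1 - (j + 1)) := by
      rw [Finset.sum_mul]
      refine Finset.sum_congr rfl fun j hj => ?_
      rw [Nat.add_sub_add_right, Nat.choose_succ_succ' j 1, Nat.choose_one_right]
      ring
    rw [hy, hx, add_assoc, ← Finset.sum_add_distrib, add_comm, Finset.sum_range_succ' _ (n + 1)]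
    congr 1
    · refine Finset.sum_congr rfl fun j hj => ?_
      rw [qBinomial_succ_succ]; ring
    · simp [qBinomial_zero_right]

theorem choose_two_add (n m : ℕ) : (n + m).choose 2 = n.choose 2 + m.choose 2 + n * m := by
  induction m with
  | zero => simp
  | succ m ih =>
    rw [← add_assoc, Nat.choose_succ_succ' (n + m) 1, ih, Nat.choose_succ_succ' m 1,
      Nat.choose_one_right, Nat.choose_one_right]
    ring

theorem choose_two_mul_two_add (n : ℕ) : n.choose 2 * 2 + n = n ^ 2 := by
  induction n with
  | zero => simp
  | succ n ih =>
    rw [Nat.choose_succ_succ' n 1, Nat.choose_one_right]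
    linear_combination ih

open PowerSeries in
/-- The finite form of the Jacobi triple product, in base `X ^ M` at `- X ^ i`. -/
theorem finite_jacobi_triple_product (r i n : ℕ) (hir : i ≤ r) :
    (∏ j ∈ Finset.range n, ((1 - X ^ ((2 * r + 1) * j + i)) *
      (1 - X ^ ((2 * r + 1) * (j + 1) - i))) : PowerSeries ℤ) =
    ∑ p ∈ Finset.range (n + 1), (-1) ^ p * X ^ (r * p ^ 2 + (r - i) * p + (p + 1).choose 2) *
        qBinomial (X ^ (2 * r + 1)) (2 * n) (n - p) -
      ∑ p ∈ Finset.range n, (-1) ^ p *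
        X ^ (r * p ^ 2 + (r - i) * p + (p + 1).choose 2 + (2 * p + 1) * i) *
        qBinomial (X ^ (2 * r + 1)) (2 * n) (n + 1 + p) := by
  obtain ⟨c, rfl⟩ := Nat.exists_eq_add_of_le hir
  set M := 2 * (i + c) + 1 with hM
  -- With `y = X^(M n)` the `2 n` factors are `X^(M n) - X^(M j + i)`. For `j < n` the power `-X^(M
  -- j + i)` comes out, for `j ≥ n` the power `X^(M n)`; together they form the monomial of `hne`,
  -- to be cancelled.
  have key := prod_add_mul_pow_eq_sum_qBinomial (X ^ M : PowerSeries ℤ) (-X ^ i) (X ^ (M * n))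
    (2 * n)
  have hne : ((-1) ^ n * X ^ (i * n + M * n.choose 2 + M * n * n) : PowerSeries ℤ) ≠ 0 :=
    mul_ne_zero (pow_ne_zero _ (by simp)) (pow_ne_zero _ X_ne_zero)
  apply mul_left_cancel₀ hne
  have hl : (∏ j ∈ Finset.range (2 * n), (X ^ (M * n) + -X ^ i * (X ^ M) ^ j) : PowerSeries ℤ) =
      (-1) ^ n * X ^ (i * n + M * n.choose 2 + M * n * n) *
      (∏ j ∈ Finset.range n, ((1 - X ^ (M * j + i)) * (1 - X ^ (M * (j + 1) - i)))) := by
    have e1 : ∏ j ∈ Finset.range n, (X ^ (M * n) + -X ^ i * (X ^ M) ^ j : PowerSeries ℤ) =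
        (∏ j ∈ Finset.range n, (-1 * (X ^ i * X ^ (M * j)))) *
          ∏ j ∈ Finset.range n, (1 - X ^ (M * (n - 1 - j + 1) - i)) := by
      rw [← Finset.prod_mul_distrib]
      refine Finset.prod_congr rfl fun j hj => ?_
      have hj' := Finset.mem_range.1 hj
      obtain ⟨d, rfl⟩ := Nat.exists_eq_add_of_lt hj'
      have : M * (j + d + 1) = i + M * j + (M * (j + d + 1 - 1 - j + 1) - i) := by
        rw [show j + d + 1 - 1 - j + 1 = d + 1 by omega]
        have : i ≤ M * (d + 1) := by nlinarith
        have : M * (j + d + 1) = M * j + M * (d + 1) := by ring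
        omega
      rw [this, pow_add, pow_add, ← pow_mul]
      ring
    have e2 : ∏ j ∈ Finset.range n, (X ^ (M * n) + -X ^ i * (X ^ M) ^ (n + j) : PowerSeries ℤ) =
        (∏ j ∈ Finset.range n, X ^ (M * n)) *
          ∏ j ∈ Finset.range n, (1 - X ^ (M * j + i)) := by
      rw [← Finset.prod_mul_distrib]
      refine Finset.prod_congr rfl fun j hj => ?_
      rw [← pow_mul, mul_add, pow_add, pow_add]
      ring
    have e3 : ∏ j ∈ Finset.range n, (X ^ (M * j) : PowerSeries ℤ) = X ^ (M * n.choose 2) := by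
      rw [Finset.prod_pow_eq_pow_sum, ← Finset.mul_sum, Finset.sum_range_id, Nat.choose_two_right]
    rw [two_mul, Finset.prod_range_add, e1, e2,
      Finset.prod_range_reflect (fun j => (1 - X ^ (M * (j + 1) - i) : PowerSeries ℤ)),
      Finset.prod_mul_distrib, Finset.prod_mul_distrib, Finset.prod_mul_distrib, e3]
    simp only [Finset.prod_const, Finset.card_range]
    rw [← pow_mul, ← pow_mul, pow_add, pow_add]
    ring
  -- The sum is cut at its centre: index `n - p` in the first half, `n + 1 + p` in the second.
  rw [← hl, key, show 2 * n + 1 = (n + 1) + n by ring, Finset.sum_range_add, mul_sub,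
    Finset.mul_sum, Finset.mul_sum, sub_eq_add_neg, ← Finset.sum_neg_distrib]
  congr 1
  · rw [← Finset.sum_range_reflect]
    refine Finset.sum_congr rfl fun p hp => ?_
    obtain ⟨d, rfl⟩ := Nat.exists_eq_add_of_le (Nat.lt_succ_iff.1 (Finset.mem_range.1 hp))
    have hs : (-1 : PowerSeries ℤ) ^ d = (-1) ^ (p + d) * (-1) ^ p := by
      rw [pow_add, mul_right_comm, ← mul_pow]; simp
    -- Eliminating the binomial coefficient makes the comparison of exponents `he` a polynomial
    -- identity.
    have hC : ((p.choose 2 : ℕ) : ℤ) * 2 + p = p ^ 2 := mod_cast choose_two_mul_two_add p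
    have he : M * d.choose 2 + i * d + M * (p + d) * (2 * (p + d) - d) =
        (i * (p + d) + M * (p + d).choose 2 + M * (p + d) * (p + d)) +
          ((i + c) * p ^ 2 + (i + c - i) * p + (p + 1).choose 2) := by
      rw [choose_two_add, choose_two_add p 1, Nat.add_sub_cancel_left,
        show 2 * (p + d) - d = 2 * p + d by omega, hM]
      simp only [Nat.choose_succ_self, Nat.add_zero, Nat.mul_one]
      zify
      linear_combination (-(i + c + 1) : ℤ) * hC
    rw [show p + d + 1 - 1 - p = d by omega, show p + d - p = d by omega, neg_pow, hs]
    simp only [← pow_mul]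
    have := congrArg (fun e => (X : PowerSeries ℤ) ^ e) he
    simp only [pow_add] at this ⊢
    linear_combination (qBinomial (X ^ M) (2 * (p + d)) d * (-1) ^ p * (-1) ^ d * (-1) ^ p) * this
  · refine Finset.sum_congr rfl fun p hp => ?_
    obtain ⟨d, rfl⟩ := Nat.exists_eq_add_of_lt (Finset.mem_range.1 hp)
    have hs : (-1 : PowerSeries ℤ) ^ (p + d + 1 + 1 + p) = -((-1) ^ (p + d + 1) * (-1) ^ p) := by
      ring
    have hC : ((p.choose 2 : ℕ) : ℤ) * 2 + p = p ^ 2 := mod_cast choose_two_mul_two_add p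
    have he : M * (p + d + 1 + 1 + p).choose 2 + i * (p + d + 1 + 1 + p) +
          M * (p + d + 1) * (2 * (p + d + 1) - (p + d + 1 + 1 + p)) =
        (i * (p + d + 1) + M * (p + d + 1).choose 2 + M * (p + d + 1) * (p + d + 1)) +
          ((i + c) * p ^ 2 + (i + c - i) * p + (p + 1).choose 2 + (2 * p + 1) * i) := by
      rw [show p + d + 1 + 1 + p = (p + d + 1) + (p + 1) by omega, choose_two_add (p + d + 1),
        choose_two_add p 1, Nat.add_sub_cancel_left,
        show 2 * (p + d + 1) - (p + d + 1 + (p + 1)) = d by omega, hM]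
      simp only [Nat.choose_succ_self, Nat.add_zero, Nat.mul_one]
      zify
      linear_combination ((i + c) : ℤ) * hC
    rw [neg_pow, hs]
    simp only [← pow_mul]
    have := congrArg (fun e => (X : PowerSeries ℤ) ^ e) he
    simp only [pow_add] at this ⊢
    linear_combination (-qBinomial (X ^ M) (2 * (p + d + 1)) (p + d + 1 + 1 + p) * (-1) ^ p *
      (-1) ^ d * (-1) * (-1) ^ p) * this

/-! ### Truncation modulo `X ^ N` and the product side -/

/-- Reduction of integral power series modulo `X ^ N`. -/
noncomputable abbrev modX (N : ℕ) : PowerSeries ℤ →+*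
    PowerSeries ℤ ⧸ Ideal.span {(PowerSeries.X : PowerSeries ℤ) ^ N} :=
  Ideal.Quotient.mk _

section ModX

open PowerSeries

theorem modX_eq_modX_iff {N : ℕ} {a b : PowerSeries ℤ} :
    modX N a = modX N b ↔ X ^ N ∣ a - b := by
  rw [Ideal.Quotient.eq, Ideal.mem_span_singleton]

theorem modX_eq_zero_iff {N : ℕ} {a : PowerSeries ℤ} : modX N a = 0 ↔ X ^ N ∣ a := by
  rw [Ideal.Quotient.eq_zero_iff_mem, Ideal.mem_span_singleton]

theorem modX_X_pow {N m : ℕ} (h : N ≤ m) : modX N (X ^ m) = 0 :=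
  modX_eq_zero_iff.2 (pow_dvd_pow _ h)

theorem eq_of_forall_modX_eq {a b : PowerSeries ℤ} (h : ∀ N, modX N a = modX N b) : a = b := by
  rw [← sub_eq_zero]
  ext n
  exact X_pow_dvd_iff.1 (modX_eq_modX_iff.1 (h (n + 1))) n n.lt_succ_self

theorem modX_prod_range {N n : ℕ} {f : ℕ → PowerSeries ℤ} (hn : N ≤ n)
    (hf : ∀ m, N ≤ m → modX N (f m) = 1) :
    modX N (∏ m ∈ Finset.range n, f m) = modX N (∏ m ∈ Finset.range N, f m) := by
  induction n, hn using Nat.le_induction with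
  | base => rfl
  | succ n hn ih => rw [Finset.prod_range_succ, map_mul, ih, hf n hn, mul_one]

theorem modX_sum_range {N n : ℕ} {f : ℕ → PowerSeries ℤ} (hn : N ≤ n)
    (hf : ∀ m, N ≤ m → modX N (f m) = 0) :
    modX N (∑ m ∈ Finset.range n, f m) = modX N (∑ m ∈ Finset.range N, f m) := by
  induction n, hn using Nat.le_induction with
  | base => rfl
  | succ n hn ih => rw [Finset.sum_range_succ, map_add, ih, hf n hn, add_zero]

theorem modX_one_sub_X_pow {N m : ℕ} (h : N ≤ m) : modX N (1 - X ^ m) = 1 := by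
  rw [map_sub, modX_X_pow h, map_one, sub_zero]

theorem modX_qFactorial {N M n : ℕ} (hM : 1 ≤ M) (hn : N ≤ n) :
    modX N (qFactorial (X ^ M) n) = modX N (qFactorial (X ^ M) N) :=
  modX_prod_range hn fun m hm => by
    rw [← pow_mul]
    exact modX_one_sub_X_pow (by nlinarith)

theorem isUnit_qFactorial {M : ℕ} (hM : 1 ≤ M) (n : ℕ) :
    IsUnit (qFactorial (X ^ M : PowerSeries ℤ) n) := by
  rw [isUnit_iff_constantCoeff, qFactorial, map_prod]
  simp [zero_pow (by omega : M ≠ 0)]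

/-- All the `q`-factorials of length at least `N` agree modulo `X^N` and are units, so the factorial
formula for the binomial collapses. -/
theorem modX_qBinomial_mul_qFactorial {N M a b n : ℕ} (hM : 1 ≤ M) (ha : N ≤ a) (hb : N ≤ b)
    (hn : N ≤ n) :
    modX N (qBinomial (X ^ M) (a + b) a) * modX N (qFactorial (X ^ M) n) = 1 := by
  have h := congrArg (modX N) (qBinomial_mul_qFactorial (X ^ M : PowerSeries ℤ) a b)
  rw [map_mul, map_mul, modX_qFactorial hM ha, modX_qFactorial hM hb,
    modX_qFactorial hM (by omega : N ≤ a + b)] at h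
  rw [modX_qFactorial hM hn]
  have hu : IsUnit (modX N (qFactorial (X ^ M) N)) := (isUnit_qFactorial hM N).map _
  apply hu.mul_right_cancel
  rw [mul_assoc, h, one_mul]

/-- `(1 - X ^ (n + 1)) ⋯ (1 - X ^ (n + J))`. -/
noncomputable def shiftedQFactorial (n J : ℕ) : PowerSeries ℤ :=
  ∏ j ∈ Finset.range J, (1 - X ^ (n + j + 1))

/-- The terms of the series `gordonTheta`. -/
noncomputable def gordonThetaTerm (r i J n : ℕ) : PowerSeries ℤ :=
  (-1) ^ n * X ^ (J * r * n + r * n ^ 2 + (r - i) * n + (n + 1).choose 2) *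
    (1 - X ^ ((J + 2 * n + 1) * i)) * shiftedQFactorial n J

/-- The first `N` terms of the alternating series that equals `(q; q)_∞` times the function
`J_{r,i}(0; q ^ J; q)` of Andrews. -/
noncomputable def gordonTheta (r i J N : ℕ) : PowerSeries ℤ :=
  ∑ n ∈ Finset.range N, gordonThetaTerm r i J n

/-- The factors `1 - X^((2r+1)(j+1))` form the `q`-factorial that cancels each Gaussian binomial
modulo `X^N`. Taking `2 * N` factors keeps both lower arguments of every binomial with `p < N` at
least `N`. -/
theorem modX_jacobi_triple_product {r i : ℕ} (hr : 1 ≤ r) (hir : i ≤ r) (N : ℕ) :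
    modX N (∏ j ∈ Finset.range (2 * N), ((1 - X ^ ((2 * r + 1) * j + i)) *
      (1 - X ^ ((2 * r + 1) * (j + 1) - i)) * (1 - X ^ ((2 * r + 1) * (j + 1))))) =
    modX N (gordonTheta r i 0 N) := by
  have hq : ∏ j ∈ Finset.range (2 * N), (1 - X ^ ((2 * r + 1) * (j + 1)) : PowerSeries ℤ) =
      qFactorial (X ^ (2 * r + 1)) (2 * N) := by
    simp only [qFactorial, pow_mul]
  have hbd (p : ℕ) (hp : N ≤ p) : N ≤ r * p ^ 2 + (r - i) * p + (p + 1).choose 2 := by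
    have : p * 1 ≤ p ^ 2 * r := Nat.mul_le_mul (Nat.le_self_pow two_ne_zero p) hr
    rw [mul_one, mul_comm] at this
    omega
  rw [Finset.prod_mul_distrib, hq, finite_jacobi_triple_product r i (2 * N) hir, map_mul, map_sub,
    modX_sum_range (by omega : N ≤ 2 * N + 1), modX_sum_range (by omega : N ≤ 2 * N), ← map_sub,
    ← map_mul, ← Finset.sum_sub_distrib, Finset.sum_mul, gordonTheta, map_sum, map_sum]
  · refine Finset.sum_congr rfl fun p hp => ?_
    have hp' := Finset.mem_range.1 hp
    have h1 := modX_qBinomial_mul_qFactorial (N := N) (M := 2 * r + 1) (a := 2 * N - p)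
      (b := 2 * N + p) (n := 2 * N) (by omega) (by omega) (by omega) (by omega)
    have h2 := modX_qBinomial_mul_qFactorial (N := N) (M := 2 * r + 1) (a := 2 * N + 1 + p)
      (b := 2 * N - 1 - p) (n := 2 * N) (by omega) (by omega) (by omega) (by omega)
    rw [show 2 * N - p + (2 * N + p) = 2 * (2 * N) by omega] at h1
    rw [show 2 * N + 1 + p + (2 * N - 1 - p) = 2 * (2 * N) by omega] at h2
    simp only [gordonThetaTerm, shiftedQFactorial, sub_mul, map_sub, map_mul, mul_assoc, h1, h2]
    simp [pow_add, mul_sub, mul_assoc]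
  · intro p hp
    rw [map_mul, map_mul, modX_X_pow ((hbd p hp).trans (Nat.le_add_right _ _))]
    simp
  · intro p hp
    rw [map_mul, map_mul, modX_X_pow (hbd p hp)]
    simp

theorem int_modEq_iff_of_abs_lt {x s u k M : ℤ} (h : s - x = u + M * k) (hu : |u| < M) :
    x ≡ s [ZMOD M] ↔ u = 0 := by
  rw [Int.modEq_iff_dvd, h, Int.dvd_add_left (dvd_mul_right M k)]
  exact ⟨fun hd => Int.eq_zero_of_abs_lt_dvd hd hu, fun h0 => h0 ▸ dvd_zero M⟩

theorem prod_range_not_allowedPart {r i : ℕ} (hi : 1 ≤ i) (hir : i ≤ r) (n : ℕ) :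
    (∏ m ∈ Finset.range ((2 * r + 1) * n),
      if AllowedPart r i (m + 1) then 1 else (1 - X ^ (m + 1)) : PowerSeries ℤ) =
    ∏ j ∈ Finset.range n, ((1 - X ^ ((2 * r + 1) * j + i)) *
      (1 - X ^ ((2 * r + 1) * (j + 1) - i)) * (1 - X ^ ((2 * r + 1) * (j + 1)))) := by
  induction n with
  | zero => simp
  | succ n ih =>
    rw [mul_add, mul_one, Finset.prod_range_add _ _ (2 * r + 1), ih, Finset.prod_range_succ _ n]
    congr 1
    -- Each block of `2r+1` consecutive integers has three excluded residues. The factor at `t` has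
    -- exponent `t + 1` within the block, so the residues `i`, `-i`, `0` sit at `t = i - 1`, `2r -
    -- i`, `2r`, which are distinct because `1 ≤ i ≤ r`.
    have hs : ∀ t ∈ Finset.range (2 * r + 1), (AllowedPart r i ((2 * r + 1) * n + t + 1) ↔
        t ∉ ({i - 1, 2 * r - i, 2 * r} : Finset ℕ)) := by
      intro t ht
      have ht' := Finset.mem_range.1 ht
      rw [AllowedPart,
        int_modEq_iff_of_abs_lt (k := -(n + 1)) (u := 2 * r - t) (by push_cast; ring) (by grind),
        int_modEq_iff_of_abs_lt (k := -n) (u := i - (t + 1)) (by push_cast; ring) (by grind),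
        int_modEq_iff_of_abs_lt (k := -(n + 1)) (u := 2 * r - i - t) (by push_cast; ring)
          (by grind)]
      simp only [Finset.mem_insert, Finset.mem_singleton]
      omega
    rw [Finset.prod_congr rfl fun t ht => if_congr (hs t ht) rfl rfl]
    simp only [ite_not]
    rw [Finset.prod_ite_mem, Finset.inter_eq_right.2, Finset.prod_insert, Finset.prod_insert,
      Finset.prod_singleton, ← mul_assoc, mul_add, mul_one,
      show (2 * r + 1) * n + (i - 1) + 1 = (2 * r + 1) * n + i by omega,
      show (2 * r + 1) * n + (2 * r - i) + 1 = (2 * r + 1) * n + (2 * r + 1) - i by omega,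
      ← add_assoc]
    · simp only [Finset.mem_singleton]; omega
    · simp only [Finset.mem_insert, Finset.mem_singleton]; omega
    · intro t
      simp only [Finset.mem_insert, Finset.mem_singleton, Finset.mem_range]; omega

theorem modX_prod_not_allowedPart {r i : ℕ} (hi : 1 ≤ i) (hir : i ≤ r) (N : ℕ) :
    modX N (∏ m ∈ Finset.range N, if AllowedPart r i (m + 1) then 1 else (1 - X ^ (m + 1))) =
      modX N (gordonTheta r i 0 N) := by
  rw [← modX_jacobi_triple_product (hi.trans hir) hir, ← prod_range_not_allowedPart hi hir,
    modX_prod_range (n := (2 * r + 1) * (2 * N)) (by nlinarith)]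
  intro m hm
  split_ifs
  · exact map_one _
  · exact modX_one_sub_X_pow (by omega)

-- Each coefficient of the infinite product is the limit of those of the partial products. In
-- degrees below `N` these are constant from the `N`-th partial product on.
open scoped PowerSeries.WithPiTopology in
theorem modX_gordonProduct (r : ℕ) (s : ℤ) (N : ℕ) :
    modX N (gordonProduct r s) =
      modX N (∏ m ∈ Finset.range N, if AllowedPart r s (m + 1) then eulerFactor (m + 1) else 1) := by
  set f : ℕ → PowerSeries ℤ := fun m => if AllowedPart r s (m + 1) then eulerFactor (m + 1) else 1
  have hf : ∀ m, N ≤ m → modX N (f m) = 1 := by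
    intro m hm
    simp only [f]
    split_ifs
    · have h := congrArg (modX N) (eulerFactor_mul (m + 1) (by omega))
      rwa [map_mul, modX_one_sub_X_pow (by omega), mul_one, map_one] at h
    · exact map_one _
  rw [modX_eq_modX_iff, X_pow_dvd_iff]
  intro d hd
  rw [map_sub, sub_eq_zero]
  have ht : Filter.Tendsto (fun n => coeff d (∏ m ∈ Finset.range n, f m)) Filter.atTop
      (nhds (coeff d (gordonProduct r s))) :=
    ((WithPiTopology.continuous_coeff ℤ d).tendsto _).comp
      (gordonProduct_multipliable r s).hasProd.tendsto_prod_nat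
  refine tendsto_nhds_unique ht (tendsto_const_nhds.congr' ?_)
  filter_upwards [Filter.eventually_ge_atTop N] with n hn
  have := X_pow_dvd_iff.1 (modX_eq_modX_iff.1 (modX_prod_range hn hf)) d hd
  rw [map_sub, sub_eq_zero] at this
  exact this.symm

/-- Multiplying by `qFactorial X N` cancels the allowed factors and leaves the excluded ones, to
which the triple product applies. -/
theorem modX_gordonProduct_mul {r i : ℕ} (hi : 1 ≤ i) (hir : i ≤ r) (N : ℕ) :
    modX N (gordonProduct r i * qFactorial X N) = modX N (gordonTheta r i 0 N) := by
  rw [map_mul, modX_gordonProduct, ← map_mul, qFactorial, ← Finset.prod_mul_distrib,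
    ← modX_prod_not_allowedPart hi hir]
  congr 1
  refine Finset.prod_congr rfl fun m _ => ?_
  split_ifs
  · exact eulerFactor_mul (m + 1) (by omega)
  · exact one_mul _

end ModX

/-! ### Gordon's partitions and their recursion -/

/-- The partitions of `n`, as multisets of parts, with all parts greater than `J`, with fewer than
`i` parts equal to `J + 1`, and with fewer than `r` parts in any set `{a, a + 1}`. -/
def gordonSet (r i J n : ℕ) : Set (Multiset ℕ) :=
  {s | (∀ a ∈ s, J < a) ∧ s.count (J + 1) < i ∧ (∀ a, s.count a + s.count (a + 1) < r) ∧ s.sum = n}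

theorem gordonSet_finite (r i J n : ℕ) : (gordonSet r i J n).Finite := by
  refine (Set.finite_range (Nat.Partition.parts (n := n))).subset ?_
  rintro s ⟨h1, -, -, h4⟩
  exact ⟨⟨s, fun {a} ha => (Nat.zero_le J).trans_lt (h1 a ha), h4⟩, rfl⟩

/-- The generating function of the cardinalities of the sets `gordonSet r i J n`. -/
noncomputable def gordonSeries (r i J : ℕ) : PowerSeries ℤ :=
  PowerSeries.mk fun n => ((gordonSet r i J n).ncard : ℤ)

theorem gordonSeries_zero (r J : ℕ) : gordonSeries r 0 J = 0 := by
  ext n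
  simp [gordonSeries, gordonSet]

/-- The new multisets have exactly `i` copies of `J + 1`. Deleting these leaves parts above `J + 1`,
and the bound on adjacent multiplicities allows fewer than `r - i` copies of `J + 2`. -/
theorem gordonSet_succ {r i J n : ℕ} (hir : i < r) :
    gordonSet r (i + 1) J n = gordonSet r i J n ∪
      if (J + 1) * i ≤ n then
        (· + Multiset.replicate i (J + 1)) '' gordonSet r (r - i) (J + 1) (n - (J + 1) * i)
      else ∅ := by
  ext s
  constructor
  · rintro ⟨h1, h2, h3, h4⟩
    by_cases h5 : s.count (J + 1) < i
    · exact Or.inl ⟨h1, h5, h3, h4⟩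
    have hc : s.count (J + 1) = i := by omega
    obtain ⟨t, ht⟩ := Multiset.le_iff_exists_add.1 (Multiset.le_count_iff_replicate_le.1 hc.ge)
    rw [add_comm] at ht
    have hct : t.count (J + 1) = 0 := by
      rw [ht, Multiset.count_add, Multiset.count_replicate_self] at hc
      omega
    have hsum : t.sum + (J + 1) * i = n := by
      rw [← h4, ht, Multiset.sum_add, Multiset.sum_replicate, smul_eq_mul, mul_comm]
    right
    rw [if_pos (by omega)]
    refine ⟨t, ⟨fun a ha => ?_, ?_, fun a => ?_, by omega⟩, ht.symm⟩
    · have : J < a := h1 a (by rw [ht]; exact Multiset.mem_add.2 (Or.inl ha))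
      have : a ≠ J + 1 := by
        rintro rfl
        exact Multiset.count_eq_zero.1 hct ha
      omega
    · have h := h3 (J + 1)
      have : t.count (J + 1 + 1) ≤ s.count (J + 1 + 1) :=
        Multiset.count_le_of_le _ (ht ▸ Multiset.le_add_right _ _)
      omega
    · have h := h3 a
      have (b : ℕ) : t.count b ≤ s.count b :=
        Multiset.count_le_of_le _ (ht ▸ Multiset.le_add_right _ _)
      have h5 := this a
      have h6 := this (a + 1)
      omega
  · rintro (⟨h1, h2, h3, h4⟩ | h)
    · exact ⟨h1, h2.trans i.lt_succ_self, h3, h4⟩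
    split_ifs at h with hn
    swap
    · exact h.elim
    obtain ⟨t, ⟨h1, h2, h3, h4⟩, rfl⟩ := h
    have h0 (a : ℕ) (ha : a ≤ J + 1) : t.count a = 0 :=
      Multiset.count_eq_zero.2 fun h => (h1 a h).not_ge ha
    refine ⟨fun a ha => ?_, ?_, fun a => ?_, ?_⟩
    · rcases Multiset.mem_add.1 ha with ha | ha
      · exact (Nat.lt_succ_self J).trans (h1 a ha)
      · rw [Multiset.eq_of_mem_replicate ha]; exact J.lt_succ_self
    · simp [h0 (J + 1) le_rfl]
    · have h3a := h3 a
      simp only [Multiset.count_add, Multiset.count_replicate]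
      rcases lt_trichotomy a (J + 1) with ha | rfl | ha
      · rw [h0 a (by omega), h0 (a + 1) (by omega)]
        split_ifs <;> omega
      · rw [h0 _ le_rfl]
        split_ifs <;> omega
      · split_ifs <;> omega
    · simp only [Multiset.sum_add, Multiset.sum_replicate, smul_eq_mul, h4]
      rw [mul_comm i]
      omega

theorem ncard_gordonSet_succ {r i J n : ℕ} (hir : i < r) :
    (gordonSet r (i + 1) J n).ncard = (gordonSet r i J n).ncard +
      if (J + 1) * i ≤ n then (gordonSet r (r - i) (J + 1) (n - (J + 1) * i)).ncard else 0 := by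
  rw [gordonSet_succ hir]
  split_ifs with hn
  · rw [Set.ncard_union_eq _ (gordonSet_finite _ _ _ _) ((gordonSet_finite _ _ _ _).image _),
      Set.ncard_image_of_injective _ (add_left_injective _)]
    rw [Set.disjoint_left]
    rintro _ ⟨-, h, -, -⟩ ⟨t, -, rfl⟩
    simp at h
  · simp

section GordonSeries

open PowerSeries

theorem gordonSeries_succ {r i : ℕ} (J : ℕ) (hir : i < r) :
    gordonSeries r (i + 1) J =
      gordonSeries r i J + X ^ ((J + 1) * i) * gordonSeries r (r - i) (J + 1) := by
  ext n
  rw [map_add, coeff_X_pow_mul']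
  simp only [gordonSeries, coeff_mk, ncard_gordonSet_succ hir]
  push_cast
  rfl

theorem modX_gordonSeries {r i J N : ℕ} (hi : 1 ≤ i) (hir : i ≤ r) (hN : N ≤ J + 1) :
    modX N (gordonSeries r i J) = 1 := by
  rw [← map_one (modX N), modX_eq_modX_iff, X_pow_dvd_iff]
  intro m hm
  rw [map_sub, sub_eq_zero, gordonSeries, coeff_mk, coeff_one]
  split_ifs with h0
  · subst h0
    suffices gordonSet r i J 0 = {0} by simp [this]
    ext s
    constructor
    · rintro ⟨h1, -, -, h4⟩
      refine Multiset.eq_zero_of_forall_notMem fun a ha => ?_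
      have := Multiset.sum_eq_zero_iff.1 h4 a ha
      have := h1 a ha
      omega
    · rintro rfl
      exact ⟨by simp, by simp; omega, fun a => by simp; omega, by simp⟩
  · suffices gordonSet r i J m = ∅ by simp [this]
    rw [Set.eq_empty_iff_forall_notMem]
    rintro s ⟨h1, -, -, h4⟩
    obtain ⟨a, ha⟩ := Multiset.exists_mem_of_ne_zero (s := s) (by rintro rfl; simp at h4; omega)
    have := Multiset.le_sum_of_mem ha
    have := h1 a ha
    omega

/-! ### The same recursion for the alternating series -/

theorem gordonTheta_zero (r J N : ℕ) : gordonTheta r 0 J N = 0 := by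
  simp [gordonTheta, gordonThetaTerm]

theorem shiftedQFactorial_succ (n J : ℕ) :
    shiftedQFactorial n (J + 1) = shiftedQFactorial n J * (1 - X ^ (n + J + 1)) :=
  Finset.prod_range_succ _ _

theorem shiftedQFactorial_succ_left (n J : ℕ) :
    shiftedQFactorial n (J + 1) = (1 - X ^ (n + 1)) * shiftedQFactorial (n + 1) J := by
  rw [shiftedQFactorial, Finset.prod_range_succ', mul_comm, add_zero, shiftedQFactorial]
  congr 1
  exact Finset.prod_congr rfl fun j _ => by rw [show n + (j + 1) + 1 = n + 1 + j + 1 by ring]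

/-- The part of `gordonThetaTerm r (i + 1) J n - gordonThetaTerm r i J n` that telescopes. -/
noncomputable def gordonThetaAux (r i J n : ℕ) : PowerSeries ℤ :=
  (-1) ^ n * X ^ (J * r * n + r * n ^ 2 + (r - i - 1) * n + (n + 1).choose 2) *
    (1 - X ^ n) * shiftedQFactorial n J

/-- The four monomials of the difference regroup into multiples of `1 - X^n` and of `1 - X^(n+J+1)`.
The first group is `gordonThetaAux` at `n`. The second extends the shifted factorial on the right
(`h1`) and is the leading half of the `J + 1` term, whose other half is `gordonThetaAux` at `n + 1`
by extension on the left (`h2`). -/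
theorem gordonThetaTerm_succ_sub {r i : ℕ} (J n : ℕ) (hir : i < r) :
    gordonThetaTerm r (i + 1) J n - gordonThetaTerm r i J n =
      gordonThetaAux r i J n - gordonThetaAux r i J (n + 1) +
        X ^ ((J + 1) * i) * gordonThetaTerm r (r - i) (J + 1) n := by
  obtain ⟨c, rfl⟩ := Nat.exists_eq_add_of_lt hir
  have h1 := shiftedQFactorial_succ n J
  have h2 := shiftedQFactorial_succ_left n J
  simp only [gordonThetaTerm, gordonThetaAux]
  rw [show i + c + 1 - (i + 1) = c by omega, show i + c + 1 - i = c + 1 by omega,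
    show c + 1 - 1 = c by omega, show i + c + 1 - (c + 1) = i by omega,
    choose_two_add n 1, choose_two_add (n + 1) 1, choose_two_add n 1]
  simp only [Nat.choose_succ_self, Nat.add_zero, Nat.mul_one]
  linear_combination
    -((-1) ^ n * X ^ (J * (i + c + 1) * n + (i + c + 1) * n ^ 2 + (i + c + 1) * n +
      (n.choose 2 + n) + (J + n + 1) * i)) * h1 +
    (-1) ^ n * X ^ (J * (i + c + 1) * (n + 1) + (i + c + 1) * (n + 1) ^ 2 + c * (n + 1) +
      (n.choose 2 + n + (n + 1))) * h2

theorem modX_gordonTheta_succ {r i : ℕ} (J N : ℕ) (hir : i < r) :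
    modX N (gordonTheta r (i + 1) J N) = modX N (gordonTheta r i J N +
      X ^ ((J + 1) * i) * gordonTheta r (r - i) (J + 1) N) := by
  have h : gordonTheta r (i + 1) J N = gordonTheta r i J N +
      X ^ ((J + 1) * i) * gordonTheta r (r - i) (J + 1) N - gordonThetaAux r i J N := by
    have h0 : gordonThetaAux r i J 0 = 0 := by simp [gordonThetaAux]
    have h1 := Finset.sum_congr rfl fun n (_ : n ∈ Finset.range N) =>
      gordonThetaTerm_succ_sub J n hir
    rw [Finset.sum_sub_distrib, Finset.sum_add_distrib, Finset.sum_range_sub', h0,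
      ← Finset.mul_sum] at h1
    simp only [gordonTheta]
    linear_combination h1
  -- The only boundary term left by telescoping is divisible by `X^N`, since `r N² ≥ N`.
  have h2 : modX N (gordonThetaAux r i J N) = 0 := by
    have : N * 1 ≤ N ^ 2 * r := Nat.mul_le_mul (Nat.le_self_pow two_ne_zero N) (by omega)
    rw [mul_one, mul_comm] at this
    rw [gordonThetaAux, map_mul, map_mul, map_mul, modX_X_pow (by omega)]
    simp
  rw [h, map_sub, h2, sub_zero]

/-- Every term with `n ≥ 1` carries an exponent of at least `J`, so only `n = 0` survives. -/
theorem modX_gordonTheta_of_le {r i J N : ℕ} (hi : 1 ≤ i) (hir : i ≤ r) (hN : N ≤ J) :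
    modX N (gordonTheta r i J N) = modX N (qFactorial X N) := by
  rcases Nat.eq_zero_or_pos N with rfl | hpos
  · rw [modX_eq_modX_iff, pow_zero]; exact one_dvd _
  obtain ⟨M, rfl⟩ := Nat.exists_eq_add_of_le' hpos
  rw [gordonTheta, Finset.sum_range_succ', map_add, map_sum, Finset.sum_eq_zero, zero_add]
  · rw [gordonThetaTerm, shiftedQFactorial, map_mul, map_mul,
      modX_one_sub_X_pow (by nlinarith : M + 1 ≤ (J + 2 * 0 + 1) * i),
      modX_prod_range hN (fun m hm => modX_one_sub_X_pow (by omega))]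
    simp [qFactorial]
  · intro n _
    have : J * 1 ≤ J * (r * (n + 1)) := Nat.mul_le_mul le_rfl (Nat.mul_pos (by omega) (by omega))
    rw [mul_one, ← mul_assoc] at this
    rw [gordonThetaTerm, map_mul, map_mul, map_mul, modX_X_pow (by omega)]
    simp

/-- The recursion lowers `i` or raises `J`. It ends at `i = 0`, where both sides vanish, or at `J ≥
N`, where both are explicit; `d` bounds the distance of `J` from `N`. -/
theorem modX_gordonSeries_mul {r i : ℕ} (J N : ℕ) (hir : i ≤ r) :
    modX N (gordonSeries r i J * qFactorial X N) = modX N (gordonTheta r i J N) := by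
  obtain ⟨d, hd⟩ : ∃ d, N ≤ J + d := ⟨N, Nat.le_add_left _ _⟩
  induction d generalizing i J with
  | zero =>
    rcases Nat.eq_zero_or_pos i with rfl | hi
    · rw [gordonSeries_zero, gordonTheta_zero, zero_mul]
    · rw [map_mul, modX_gordonSeries hi hir (by omega), one_mul,
        modX_gordonTheta_of_le hi hir (by omega)]
  | succ d ih =>
    induction i with
    | zero => rw [gordonSeries_zero, gordonTheta_zero, zero_mul]
    | succ i ihi =>
      rw [gordonSeries_succ J hir, modX_gordonTheta_succ J N hir, add_mul, map_add, map_add,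
        ihi (by omega), mul_assoc, map_mul, ih (i := r - i) (J + 1) (by omega) (by omega), map_mul]

theorem gordonProduct_eq_gordonSeries {r i : ℕ} (hi : 1 ≤ i) (hir : i ≤ r) :
    gordonProduct r i = gordonSeries r i 0 := by
  refine eq_of_forall_modX_eq fun N => ?_
  have hu : IsUnit (modX N (qFactorial X N)) := by
    have := isUnit_qFactorial le_rfl N
    rw [pow_one] at this
    exact this.map _
  apply hu.mul_right_cancel
  rw [← map_mul, ← map_mul, modX_gordonProduct_mul hi hir, modX_gordonSeries_mul 0 N hir]

/-- For `i < r`, `gordonSeries_succ` at `r - i` is the defining recursion of `seriesA` cleared of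
its denominator. For `i = r` it is used at index `0`, where the vanishing of `gordonSeries r 0 J`
gives the rule `seriesA_rec_one`. -/
theorem seriesA_eq_gordonSeries {r i : ℕ} (J : ℕ) (hr : 2 ≤ r) (hi : 1 ≤ i) (hir : i ≤ r) :
    seriesA r ((r - 1) * J + (r - i + 1)) = HahnSeries.ofPowerSeries ℤ ℤ (gordonSeries r i J) := by
  induction J generalizing i with
  | zero =>
    rw [mul_zero, zero_add, seriesA_base _ _ (by omega), ← gordonProduct_eq_gordonSeries hi hir]
    congr 2
    push_cast [Nat.cast_sub hir]
    ring
  | succ J ih =>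
    rcases hir.eq_or_lt with rfl | hlt
    · have h := gordonSeries_succ (r := i) (i := 0) J (by omega)
      have h1 := ih (i := 1) le_rfl hi
      rw [gordonSeries_zero, mul_zero, pow_zero, one_mul, zero_add, zero_add, Nat.sub_zero] at h
      rw [Nat.sub_self, zero_add, seriesA_rec_one _ _ hr (by omega), Nat.add_sub_cancel, ← h, ← h1,
        Nat.sub_add_cancel hi]
    · have h := gordonSeries_succ (r := r) (i := r - i) J (by omega)
      have h1 := ih (i := r - i + 1) (by omega) (by omega)
      have h2 := ih (i := r - i) (by omega) (by omega)
      rw [Nat.sub_sub_self hir] at h h2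
      rw [seriesA_rec _ _ _ hr (by omega) (by omega) (by omega), Nat.add_sub_cancel, Nat.add_sub_cancel,
        show r - (r - i + 1) + 1 = i by omega, show r - (r - i + 1) + 2 = i + 1 by omega,
        h2, show (r - 1) * J + i = (r - 1) * J + (r - (r - i + 1) + 1) by omega, h1, h, map_add,
        map_mul, add_sub_cancel_left, HahnSeries.ofPowerSeries_X_pow, mul_comm, ← mul_assoc,
        HahnSeries.single_mul_single]
      simp

end GordonSeries

/-! ### The difference condition as a bound on adjacent multiplicities -/

/-- In a non-increasing list the entries that are at least `t` form an initial segment. -/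
theorem List.le_getElem_iff_lt_countP {L : List ℕ} (hL : L.Pairwise (· ≥ ·)) (t k : ℕ)
    (hk : k < L.length) : t ≤ L[k] ↔ k < L.countP (t ≤ ·) := by
  induction L generalizing k with
  | nil => simp at hk
  | cons x L ih =>
    rw [List.pairwise_cons] at hL
    by_cases hx : t ≤ x
    · rw [List.countP_cons_of_pos (by simpa using hx)]
      cases k with
      | zero => simpa using hx
      | succ k => simpa using ih hL.2 k (by simpa using hk)
    · have h0 : ∀ y ∈ x :: L, ¬ t ≤ y := by
        intro y hy
        rcases List.mem_cons.1 hy with rfl | hy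
        · exact hx
        · exact fun h => hx (h.trans (hL.1 y hy))
      have hc : (x :: L).countP (t ≤ ·) = 0 := by
        rw [List.countP_eq_zero]
        simpa using h0
      rw [hc]
      simpa using h0 _ (List.getElem_mem hk)

theorem List.countP_le_eq_add (L : List ℕ) (a : ℕ) :
    L.countP (a ≤ ·) = L.countP (a + 2 ≤ ·) + (L.count a + L.count (a + 1)) := by
  induction L with
  | nil => simp
  | cons x L ih =>
    simp only [List.countP_cons, List.count_cons, ih, decide_eq_true_eq, beq_iff_eq]
    split_ifs <;> omega

theorem differenceCondition_iff {r : ℕ} (hr : 1 ≤ r) {L : List ℕ} (hL : L.Pairwise (· ≥ ·)) :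
    DifferenceCondition r L ↔ ∀ a, L.count a + L.count (a + 1) < r := by
  constructor
  · intro h a
    by_contra! hc
    have h1 := L.countP_le_eq_add a
    have h2 : L.countP (a ≤ ·) ≤ L.length := List.countP_le_length
    -- This is the position of the first entry below `a + 2`; with `r` entries in `{a, a + 1}`, the
    -- entry `r - 1` places later is still at least `a`.
    have h3 := h (L.countP (a + 2 ≤ ·)) (by omega)
    have h4 := (List.le_getElem_iff_lt_countP hL a _
      (by omega : L.countP (a + 2 ≤ ·) + (r - 1) < L.length)).2 (by omega)
    have h5 := (List.le_getElem_iff_lt_countP hL (a + 2) _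
      (by omega : L.countP (a + 2 ≤ ·) < L.length)).1 (by omega)
    omega
  · intro h m hm
    by_contra! hc
    -- If the condition fails at `m`, the entries at `m, …, m + r - 1` all lie in `{a, a + 1}` with
    -- `a = L[m + (r - 1)]`.
    have h1 := L.countP_le_eq_add (L[m + (r - 1)])
    have h2 := h (L[m + (r - 1)])
    have h3 := (List.le_getElem_iff_lt_countP hL _ _ hm).1 le_rfl
    have h4 := (List.le_getElem_iff_lt_countP hL (L[m + (r - 1)] + 2) m (by omega)).not.1
      (by omega)
    omega

theorem differenceCondition_partList_iff {r n : ℕ} (hr : 1 ≤ r) (p : n.Partition) :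
    DifferenceCondition r (partList p) ↔ ∀ a, p.parts.count a + p.parts.count (a + 1) < r := by
  rw [differenceCondition_iff (L := partList p) hr (Multiset.pairwise_sort p.parts (· ≥ ·))]
  have h (a : ℕ) : (partList p).count a = p.parts.count a := by
    rw [← Multiset.coe_count, partList, Multiset.sort_eq]
  simp only [h]

theorem natCard_partition_eq_ncard {n : ℕ} (P : n.Partition → Prop) (s : Set (Multiset ℕ))
    (hs : ∀ p : n.Partition, P p ↔ p.parts ∈ s)
    (hsum : ∀ t ∈ s, t.sum = n ∧ ∀ a ∈ t, 0 < a) : Nat.card {p // P p} = s.ncard := by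
  rw [← Nat.card_coe_set_eq]
  exact Nat.card_congr
    { toFun := fun p => ⟨p.1.parts, (hs p.1).1 p.2⟩
      invFun := fun t => ⟨⟨t.1, fun {a} ha => (hsum t.1 t.2).2 a ha, (hsum t.1 t.2).1⟩,
        (hs _).2 t.2⟩
      left_inv := fun p => rfl
      right_inv := fun t => rfl }

theorem countBJ_eq_ncard {r i J : ℕ} (hr : 1 ≤ r) (hi : 1 ≤ i) (n : ℕ) :
    countBJ r i J n = (gordonSet r i J n).ncard := by
  refine natCard_partition_eq_ncard _ _ (fun p => ?_) fun t ht =>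
    ⟨ht.2.2.2, fun a ha => (Nat.zero_le J).trans_lt (ht.1 a ha)⟩
  rw [differenceCondition_partList_iff hr]
  refine ⟨fun h => ⟨h.2.1, by omega, h.1, p.parts_sum⟩, fun h => ⟨h.2.2.1, h.1, ?_⟩⟩
  have := h.2.1
  omega

theorem countB_eq_countBJ (r i n : ℕ) : countB r i n = countBJ r i 0 n := by
  refine Nat.card_congr (Equiv.subtypeEquivRight fun p => ?_)
  exact and_congr_right' ⟨fun h => ⟨fun a ha => p.parts_pos ha, h⟩, fun h => h.2⟩

theorem seriesB_eq_gordonSeries {r i J : ℕ} (hr : 1 ≤ r) (hi : 1 ≤ i) :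
    seriesB r i J = gordonSeries r i J := by
  ext n
  rw [seriesB, gordonSeries, PowerSeries.coeff_mk, PowerSeries.coeff_mk, countBJ_eq_ncard hr hi]

open scoped PowerSeries.WithPiTopology in
theorem eulerFactor_eq_tsum (m : ℕ) :
    eulerFactor (m + 1) = ∑' j : ℕ, (PowerSeries.X ^ ((m + 1) * j) : PowerSeries ℤ) := by
  have h := PowerSeries.WithPiTopology.one_sub_mul_tsum_pow_of_constantCoeff_eq_zero
    (f := (PowerSeries.X ^ (m + 1) : PowerSeries ℤ)) (by simp)
  simp only [pow_mul]
  rw [← one_mul (∑' j : ℕ, _), ← eulerFactor_mul (m + 1) (by omega), mul_assoc, h, mul_one]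

open scoped PowerSeries.WithPiTopology in
theorem coeff_gordonProduct (r i n : ℕ) : PowerSeries.coeff n (gordonProduct r i) = countA r i n := by
  have h := Nat.Partition.powerSeriesMk_card_restricted_eq_tprod ℤ (AllowedPart r i)
  simp only [← eulerFactor_eq_tsum] at h
  rw [gordonProduct, ← h, PowerSeries.coeff_mk, countA]

/-! ### The monomial quotient and its Hilbert–Poincaré series -/

section MonomialQuotient

open MvPolynomial

/-- Exponents of monomials in the variables `x_k, x_{k+1}, …`. -/
abbrev ExponentFrom (k : ℕ) : Type := {n : ℕ // k ≤ n} →₀ ℕ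

/-- The index of the variable `x_{k+j}`. -/
def indexFrom (k j : ℕ) : {n : ℕ // k ≤ n} := ⟨k + j, Nat.le_add_right k j⟩

/-- The exponents of the generators of `gordonIdeal F r i k`. -/
noncomputable def gordonExponents (r i k : ℕ) : Set (ExponentFrom k) :=
  {Finsupp.single (indexFrom k 0) i} ∪
    {e | ∃ s, 1 ≤ s ∧ s ≤ i - 1 ∧
      e = Finsupp.single (indexFrom k 0) (i - s) + Finsupp.single (indexFrom k 1) (r - i + s)} ∪
    {e | ∃ b t, t ≤ r - 1 ∧
      e = Finsupp.single (indexFrom k (1 + b)) (r - t) +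
        Finsupp.single (indexFrom k (1 + b + 1)) t}

theorem polyVar_pow (F : Type*) [Field F] (k j m : ℕ) :
    polyVar F k j ^ m = monomial (Finsupp.single (indexFrom k j) m) (1 : F) :=
  X_pow_eq_monomial

theorem gordonIdeal_eq_span_monomial (F : Type*) [Field F] (r i k : ℕ) :
    gordonIdeal F r i k =
      Ideal.span ((fun e => monomial e (1 : F)) '' gordonExponents r i k) := by
  rw [gordonIdeal, gordonExponents]
  simp only [polyVar_pow, monomial_mul, mul_one, Set.image_union, Set.image_singleton]
  congr 2
  · congr 1
    ext f
    constructor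
    · rintro ⟨s, h1, h2, rfl⟩; exact ⟨_, ⟨s, h1, h2, rfl⟩, rfl⟩
    · rintro ⟨_, ⟨s, h1, h2, rfl⟩, rfl⟩; exact ⟨s, h1, h2, rfl⟩
  · ext f
    constructor
    · rintro ⟨b, t, h, rfl⟩; exact ⟨_, ⟨b, t, h, rfl⟩, rfl⟩
    · rintro ⟨_, ⟨b, t, h, rfl⟩, rfl⟩; exact ⟨b, t, h, rfl⟩

/-- The exponents of weight `j` of the monomials outside the ideal generated by the monomials
with exponents in `E`. -/
def standardExponents {k : ℕ} (E : Set (ExponentFrom k)) (j : ℕ) : Set (ExponentFrom k) :=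
  {f | Finsupp.weight (fun n : {n : ℕ // k ≤ n} => (n : ℕ)) f = j ∧ ∀ e ∈ E, ¬ e ≤ f}

section Quotient

variable (F : Type*) [Field F] {k : ℕ} (E : Set (ExponentFrom k)) (j : ℕ)

/-- Monomials divisible by a generator die in the quotient, so the standard ones span. -/
theorem quotientComponent_eq_map_restrictSupport :
    quotientComponent F k (Ideal.span ((fun e => monomial e (1 : F)) '' E)) j =
      (restrictSupport F (standardExponents E j)).map
        (Ideal.Quotient.mkₐ F (Ideal.span ((fun e => monomial e (1 : F)) '' E))).toLinearMap := by
  apply le_antisymm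
  · rw [quotientComponent, Submodule.map_le_iff_le_comap]
    intro f hf
    rw [Submodule.mem_comap, f.as_sum, map_sum]
    refine Submodule.sum_mem _ fun e he => ?_
    by_cases hE : ∃ e' ∈ E, e' ≤ e
    · have : monomial e (coeff e f) ∈ Ideal.span ((fun e => monomial e (1 : F)) '' E) := by
        rw [mem_ideal_span_monomial_image]
        intro x hx
        obtain rfl : e = x := by
          by_contra h
          rw [mem_support_iff, coeff_monomial, if_neg h] at hx
          exact hx rfl
        exact hE
      have h0 : (Ideal.Quotient.mkₐ F (Ideal.span ((fun e => monomial e (1 : F)) '' E))).toLinearMap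
          (monomial e (coeff e f)) = 0 := Ideal.Quotient.eq_zero_iff_mem.2 this
      rw [h0]
      exact zero_mem _
    · push Not at hE
      refine Submodule.mem_map_of_mem ((monomial_mem_restrictSupport F).2 (Or.inl ⟨?_, hE⟩))
      exact hf (mem_support_iff.1 he)
  · refine Submodule.map_mono fun f hf => ?_
    rw [mem_weightedHomogeneousSubmodule]
    intro e he
    exact (hf (mem_support_iff.2 he)).1

/-- Every monomial of a polynomial in a monomial ideal is divisible by a generator, so no nonzero
combination of standard monomials lies in the ideal. -/
theorem injective_mk_domRestrict_restrictSupport :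
    Function.Injective ((Ideal.Quotient.mkₐ F
      (Ideal.span ((fun e => monomial e (1 : F)) '' E))).toLinearMap.domRestrict
        (restrictSupport F (standardExponents E j))) := by
  rw [injective_iff_map_eq_zero]
  rintro ⟨f, hf⟩ h
  have h1 : f ∈ Ideal.span ((fun e => monomial e (1 : F)) '' E) :=
    Ideal.Quotient.eq_zero_iff_mem.1 h
  rw [mem_ideal_span_monomial_image] at h1
  rw [Submodule.mk_eq_zero, ← support_eq_empty, Finset.eq_empty_iff_forall_notMem]
  intro e he
  obtain ⟨e', he', hle⟩ := h1 e he
  exact (hf he).2 e' he' hle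

/-- The images of the standard monomials of weight `j` form a basis of the component of weight `j`
of the quotient by a monomial ideal. -/
noncomputable def quotientComponentBasis :
    Module.Basis (standardExponents E j) F
      (quotientComponent F k (Ideal.span ((fun e => monomial e (1 : F)) '' E)) j) :=
  (basisRestrictSupport F (standardExponents E j)).map <|
    (LinearEquiv.ofInjective _ (injective_mk_domRestrict_restrictSupport F E j)).trans <|
      LinearEquiv.ofEq _ _ (by
        rw [quotientComponent_eq_map_restrictSupport, LinearMap.range_domRestrict])

end Quotient

theorem single_add_single_le_iff {α : Type*} {a b : α} (hab : a ≠ b) (m n : ℕ) (f : α →₀ ℕ) :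
    Finsupp.single a m + Finsupp.single b n ≤ f ↔ m ≤ f a ∧ n ≤ f b := by
  classical
  constructor
  · intro h
    have h1 := h a
    have h2 := h b
    simp [hab, hab.symm] at h1 h2
    exact ⟨h1, h2⟩
  · rintro ⟨h1, h2⟩ c
    rw [Finsupp.add_apply, Finsupp.single_apply, Finsupp.single_apply]
    split_ifs with h3 h4 h4
    · exact absurd (h3.trans h4.symm) hab
    · subst h3; simpa using h1
    · subst h4; simpa using h2
    · simp

theorem forall_gordonExponents_not_le_iff {r i k : ℕ} (hi : 1 ≤ i) (hir : i ≤ r)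
    (f : ExponentFrom k) :
    (∀ e ∈ gordonExponents r i k, ¬ e ≤ f) ↔
      f (indexFrom k 0) < i ∧ ∀ b, f (indexFrom k b) + f (indexFrom k (b + 1)) < r := by
  have hne (b : ℕ) : indexFrom k b ≠ indexFrom k (b + 1) := by simp [indexFrom]
  constructor
  · intro h
    have h0 : f (indexFrom k 0) < i := by
      have := h _ (Or.inl (Or.inl rfl))
      rw [Finsupp.single_le_iff] at this
      omega
    -- The generators with `t = 0` are pure powers. They force both exponents to be positive when an
    -- adjacent pair sums to at least `r`, which puts the witnesses `s` and `t` below in range.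
    have h1 (b : ℕ) (hpos : 1 ≤ b) : f (indexFrom k b) < r := by
      obtain ⟨b, rfl⟩ := Nat.exists_eq_add_of_le hpos
      have := h _ (Or.inr ⟨b, 0, by omega, rfl⟩)
      rw [single_add_single_le_iff (hne _)] at this
      omega
    refine ⟨h0, fun b => ?_⟩
    have h2 := h1 (b + 1) (by omega)
    by_contra! hc
    rcases Nat.eq_zero_or_pos b with rfl | hb
    · refine h _ (Or.inl (Or.inr ⟨i - f (indexFrom k 0), by omega, by omega, rfl⟩)) ?_
      rw [single_add_single_le_iff (hne 0)]
      simp only [zero_add] at hc h2 ⊢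
      omega
    · have h3 := h1 b hb
      obtain ⟨b, rfl⟩ : ∃ c, b = 1 + c := ⟨b - 1, by omega⟩
      refine h _ (Or.inr ⟨b, r - f (indexFrom k (1 + b)), by omega, rfl⟩) ?_
      rw [single_add_single_le_iff (hne _)]
      omega
  · rintro ⟨h0, h1⟩ e ((rfl | ⟨s, hs1, hs2, rfl⟩) | ⟨b, t, ht, rfl⟩) hle
    · rw [Finsupp.single_le_iff] at hle
      omega
    · rw [single_add_single_le_iff (hne 0)] at hle
      have := h1 0
      simp only [zero_add] at this hle
      omega
    · rw [single_add_single_le_iff (hne _)] at hle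
      have := h1 (1 + b)
      omega

/-- The multiset of parts that corresponds to a monomial. -/
noncomputable def exponentParts {k : ℕ} (f : ExponentFrom k) : Multiset ℕ :=
  (Finsupp.toMultiset f).map Subtype.val

theorem exponentParts_injective (k : ℕ) : Function.Injective (exponentParts (k := k)) :=
  (Multiset.map_injective Subtype.val_injective).comp (Finsupp.orderIsoMultiset (ι := {n : ℕ // k ≤ n})).injective

theorem count_exponentParts {k : ℕ} (f : ExponentFrom k) (j : ℕ) :
    (exponentParts f).count (k + j) = f (indexFrom k j) := by
  classical
  rw [exponentParts, ← Finsupp.count_toMultiset]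
  exact Multiset.count_map_eq_count' _ _ Subtype.val_injective (indexFrom k j)

theorem le_of_mem_exponentParts {k a : ℕ} {f : ExponentFrom k} (h : a ∈ exponentParts f) :
    k ≤ a := by
  obtain ⟨b, -, rfl⟩ := Multiset.mem_map.1 h
  exact b.2

theorem sum_exponentParts {k : ℕ} (f : ExponentFrom k) :
    (exponentParts f).sum = Finsupp.weight (fun n : {n : ℕ // k ≤ n} => (n : ℕ)) f := by
  rw [exponentParts]
  induction f using Finsupp.induction_linear with
  | zero => simp
  | add f g hf hg => rw [map_add, Multiset.map_add, Multiset.sum_add, hf, hg, map_add]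
  | single a n => simp [Finsupp.toMultiset_single, Multiset.map_nsmul, Multiset.sum_nsmul,
      Finsupp.weight_single]

theorem exists_exponentParts_eq {k : ℕ} (s : Multiset ℕ) (hs : ∀ a ∈ s, k ≤ a) :
    ∃ f : ExponentFrom k, exponentParts f = s := by
  classical
  lift s to Multiset {n : ℕ // k ≤ n} using hs
  exact ⟨Multiset.toFinsupp s, by rw [exponentParts, Multiset.toFinsupp_toMultiset]⟩

theorem image_exponentParts_standardExponents {r i : ℕ} (hi : 1 ≤ i) (hir : i ≤ r) (J n : ℕ) :
    exponentParts '' standardExponents (gordonExponents r i (J + 1)) n = gordonSet r i J n := by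
  have hmem (f : ExponentFrom (J + 1)) : f ∈ standardExponents (gordonExponents r i (J + 1)) n ↔
      exponentParts f ∈ gordonSet r i J n := by
    rw [standardExponents, Set.mem_ofPred_eq, forall_gordonExponents_not_le_iff hi hir,
      gordonSet, Set.mem_ofPred_eq, ← sum_exponentParts]
    simp only [← count_exponentParts, add_zero]
    refine ⟨fun ⟨h1, h2, h3⟩ => ⟨fun a ha => le_of_mem_exponentParts ha, h2, fun a => ?_, h1⟩,
      fun ⟨_, h2, h3, h4⟩ => ⟨h4, h2, fun b => h3 _⟩⟩
    rcases lt_or_ge a (J + 1) with ha | ha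
    · rw [Multiset.count_eq_zero.2 fun h => (le_of_mem_exponentParts h).not_gt ha]
      -- For `a = J` the pair bound follows from fewer than `i ≤ r` parts `J + 1`; for smaller `a`
      -- both counts are zero.
      rcases (Nat.succ_le_of_lt ha).eq_or_lt with h | h
      · rw [show a + 1 = J + 1 from h]; omega
      · rw [Multiset.count_eq_zero.2 fun h' => (le_of_mem_exponentParts h').not_gt h]; omega
    · obtain ⟨b, rfl⟩ := Nat.exists_eq_add_of_le ha
      exact h3 b
  ext s
  constructor
  · rintro ⟨f, hf, rfl⟩
    exact (hmem f).1 hf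
  · intro hs
    obtain ⟨f, rfl⟩ := exists_exponentParts_eq (k := J + 1) s hs.1
    exact ⟨f, (hmem f).2 hs, rfl⟩

theorem finiteDimensional_quotientComponent_gordonIdeal (F : Type*) [Field F] {r i : ℕ}
    (hi : 1 ≤ i) (hir : i ≤ r) (J n : ℕ) :
    FiniteDimensional F (quotientComponent F (J + 1) (gordonIdeal F r i (J + 1)) n) := by
  have : Finite (standardExponents (gordonExponents r i (J + 1)) n) :=
    Set.Finite.of_finite_image (f := exponentParts)
      (by rw [image_exponentParts_standardExponents hi hir]; exact gordonSet_finite _ _ _ _)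
      (exponentParts_injective _).injOn
  rw [gordonIdeal_eq_span_monomial]
  exact Module.Finite.of_basis (quotientComponentBasis F _ n)

theorem finrank_quotientComponent_gordonIdeal (F : Type*) [Field F] {r i : ℕ}
    (hi : 1 ≤ i) (hir : i ≤ r) (J n : ℕ) :
    Module.finrank F (quotientComponent F (J + 1) (gordonIdeal F r i (J + 1)) n) =
      (gordonSet r i J n).ncard := by
  rw [gordonIdeal_eq_span_monomial, Module.finrank_eq_nat_card_basis (quotientComponentBasis F _ n),
    Nat.card_coe_set_eq, ← image_exponentParts_standardExponents hi hir,
    Set.ncard_image_of_injective _ (exponentParts_injective _)]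

theorem seriesHP_eq_gordonSeries (F : Type*) [Field F] {r i : ℕ} (hi : 1 ≤ i) (hir : i ≤ r)
    (J : ℕ) : seriesHP F r i (J + 1) = gordonSeries r i J := by
  ext n
  rw [seriesHP, hilbertPoincare, gordonSeries, PowerSeries.coeff_mk, PowerSeries.coeff_mk,
    finrank_quotientComponent_gordonIdeal F hi hir]

end MonomialQuotient

theorem theorem2p5 (F : Type*) [Field F] [CharZero F] (r i J ℓ : ℕ)
    (hr : 2 ≤ r) (hi : 1 ≤ i) (hir : i ≤ r) (hℓ : ℓ = r - i + 1) :
    -- the Hilbert–Poincaré series is well defined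
    (∀ j, FiniteDimensional F
      (quotientComponent F (J + 1) (gordonIdeal F r i (J + 1)) j)) ∧
    seriesA r ((r - 1) * J + ℓ) = HahnSeries.ofPowerSeries ℤ ℤ (seriesHP F r i (J + 1)) ∧
    seriesHP F r i (J + 1) = seriesB r i J ∧
    seriesA r ((r - 1) * J + ℓ) = HahnSeries.ofPowerSeries ℤ ℤ (seriesB r i J) ∧
    -- the case `J = 0`: the classical identities
    (∀ n, countA r i n = countB r i n) := by
  subst hℓ
  rw [seriesHP_eq_gordonSeries F hi hir, seriesB_eq_gordonSeries (by omega) hi]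
  refine ⟨finiteDimensional_quotientComponent_gordonIdeal F hi hir J,
    seriesA_eq_gordonSeries J hr hi hir, rfl, seriesA_eq_gordonSeries J hr hi hir, fun n => ?_⟩
  rw [countB_eq_countBJ, countBJ_eq_ncard (by omega) hi, ← Nat.cast_inj (R := ℤ),
    ← coeff_gordonProduct, gordonProduct_eq_gordonSeries hi hir, gordonSeries, PowerSeries.coeff_mk]
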